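/- **Setting.** Let $\mathcal F_0$ be the set of probability densities $f>0$ on $\mathbb R$ (with respect to Lebesgue measure) with $\int_{-\infty}^0 f=\int_0^\infty f=\tfrac12$. For $f\in\mathcal F_0$ with distribution function $F$, let $\mathcal H_{0;f}^{(n)}$ be the hypothesis that $Z_1^{(n)},\dots,Z_n^{(n)}$ are i.i.d. with density $f$. Let $R_i^{(n)}$ be the rank of $Z_i^{(n)}$ among $Z_1^{(n)},\dots,Z_n^{(n)}$, let $\mathbf N^{(n)}=(N_-^{(n)},N_+^{(n)})$ be the pair of numbers of negative and of positive $Z_i^{(n)}$, and let $\mathbf Z_{(\cdot)}^{(n)}$ be the vector of order statistics. Let $a^{(n)}$ be arbitrary real score functions, defined at $((\nu,\eta);i)$ for $\nu,\eta\in\{0,\dots,n\}$, $\eta\le n-\nu$, $i\in\{1,\dots,n\}$, let $c_1^{(n)},\dots,c_n^{(n)}$ be real constants with mean $\bar c^{(n)}$, and put $$S_{\mathbf c}^{(n)}:=\frac1n\sum_{i=1}^n c_i^{(n)}a^{(n)}(\mathbf N^{(n)};R_i^{(n)}),\qquad T_{\varphi;f}^{(n)}:=\frac1n\sum_{i=1}^n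 c_i^{(n)}\varphi(F(Z_i^{(n)})).$$ **Lemma 3.1.** Fix $f\in\mathcal F_0$. Let $\varphi:(0,1)\to\mathbb R$ be square-integrable and not almost everywhere equal to a constant, and suppose that $\varphi$ is a score-generating function for $a^{(n)}$, that is, under $\mathcal H_{0;f}^{(n)}$, as $n\to\infty$, $$\mathbb E\big[\{a^{(n)}(\mathbf N^{(n)};R_1^{(n)})-\varphi(F(Z_1^{(n)}))\}^2\,\big|\,\mathbf Z_{(\cdot)}^{(n)}\big]=o_{\mathbb P}(1).$$ Assume the Noether condition: for all sufficiently large $n$ the constants $c_i^{(n)}$, $1\le i\le n$, are not all equal, and $$\lim_{n\to\infty}\frac{\max_{1\le i\le n}(c_i^{(n)}-\bar c^{(n)})^2}{\sum_{j=1}^n(c_j^{(n)}-\bar c^{(n)})^2}=0 .$$ Assume moreover that $\sum_{i=1}^n(c_i^{(n)}-\bar c^{(n)})^2=O(n)$ as $n\to\infty$. Then: (i) under $\mathcal H_{0;f}^{(n)}$, as $n\to\infty$, $$S_{\mathbf c}^{(n)}-\mathbb E[S_{\mathbf c}^{(n)}\mid\mathbf N^{(n)}]=T_{\varphi;f}^{(n)}-\mathbb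 E[T_{\varphi;f}^{(n)}\mid\mathbf Z_{(\cdot)}^{(n)}]+o_{\mathbb P}(n^{-1/2});$$ (ii) $0<\sigma_\varphi^2:=\int_0^1\varphi^2(u)\,du-\big(\int_0^1\varphi(u)\,du\big)^2<\infty$ and, under $\mathcal H_{0;g}^{(n)}$ for every $g\in\mathcal F_0$, as $n\to\infty$, $$\frac{\sqrt n\,\big(S_{\mathbf c}^{(n)}-\mathbb E[S_{\mathbf c}^{(n)}\mid\mathbf N^{(n)}]\big)}{\sqrt{\frac1n\sum_{i=1}^n(c_i^{(n)}-\bar c^{(n)})^2}}\ \xrightarrow{\ \mathcal L\ }\ \mathcal N(0,\sigma_\varphi^2).$$ -/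

import Mathlib

open MeasureTheory ProbabilityTheory Filter Topology Set
open scoped ENNReal NNReal

noncomputable section

namespace SignRank

/-! ### Zero-median white noise -/

/-- The class of nonvanishing probability densities on the real line (with respect to Lebesgue
measure) with zero median. -/
structure ZeroMedianDensity where
  toFun : ℝ → ℝ
  pos : ∀ x, 0 < toFun x
  integrable : Integrable toFun volume
  integral_neg : ∫ x in Iio (0 : ℝ), toFun x = 1 / 2
  integral_pos : ∫ x in Ioi (0 : ℝ), toFun x = 1 / 2

namespace ZeroMedianDensity

/-- The probability measure on `ℝ` with density `f`. -/
def law (f : ZeroMedianDensity) : Measure ℝ :=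
  volume.withDensity fun x => ENNReal.ofReal (f.toFun x)

/-- The distribution function associated with the density `f`. -/
def distFun (f : ZeroMedianDensity) (x : ℝ) : ℝ :=
  ∫ t in Iic x, f.toFun t

theorem integral_eq_one (f : ZeroMedianDensity) : ∫ x, f.toFun x = 1 := by
  have h := integral_add_compl (μ := volume) (s := Iio (0 : ℝ)) measurableSet_Iio f.integrable
  rw [compl_Iio, integral_Ici_eq_integral_Ioi, f.integral_neg, f.integral_pos] at h
  linarith

instance isProbabilityMeasure_law (f : ZeroMedianDensity) : IsProbabilityMeasure f.law := by
  refine ⟨?_⟩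
  rw [law, withDensity_apply _ MeasurableSet.univ, Measure.restrict_univ,
    ← ofReal_integral_eq_lintegral_ofReal f.integrable (ae_of_all _ fun x => (f.pos x).le),
    f.integral_eq_one, ENNReal.ofReal_one]

/-- The hypothesis of independent zero-median white noise of length `n` with density `f`: the
joint law on `ℝⁿ` of `Z₁, …, Zₙ` i.i.d. with density `f`.  The random vector `Z` is the identity
of `ℝⁿ`, so that a statistic is a function `z ↦ X z` on `Fin n → ℝ`. -/
def whiteNoise (f : ZeroMedianDensity) (n : ℕ) : Measure (Fin n → ℝ) :=
  Measure.pi fun _ => f.law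

instance isProbabilityMeasure_whiteNoise (f : ZeroMedianDensity) (n : ℕ) :
    IsProbabilityMeasure (f.whiteNoise n) := by
  unfold whiteNoise; infer_instance

end ZeroMedianDensity

/-! ### Signs, ranks and order statistics -/

/-- The number of negative components of `z`. -/
def numNeg {n : ℕ} (z : Fin n → ℝ) : ℕ :=
  (Finset.univ.filter fun i => z i < 0).card

/-- The number of positive components of `z`. -/
def numPos {n : ℕ} (z : Fin n → ℝ) : ℕ :=
  (Finset.univ.filter fun i => 0 < z i).card

/-- The pair `N = (N₋, N₊)`. -/
def signCounts {n : ℕ} (z : Fin n → ℝ) : ℕ × ℕ :=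
  (numNeg z, numPos z)

/-- The rank of `z i` among the components of `z`, an element of `{1, …, n}`. -/
def rank {n : ℕ} (z : Fin n → ℝ) (i : Fin n) : ℕ :=
  (Finset.univ.filter fun j => z j ≤ z i).card

/-- The vector of order statistics: the components of `z` in nondecreasing order. -/
def orderStat {n : ℕ} (z : Fin n → ℝ) : Fin n → ℝ :=
  z ∘ Tuple.sort z

/-- The σ-algebra generated by `N = (N₋, N₊)`. -/
abbrev sigmaCounts (n : ℕ) : MeasurableSpace (Fin n → ℝ) :=
  MeasurableSpace.comap signCounts inferInstance

/-- The σ-algebra generated by the vector of order statistics. -/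
abbrev sigmaOrder (n : ℕ) : MeasurableSpace (Fin n → ℝ) :=
  MeasurableSpace.comap orderStat inferInstance

theorem measurable_card_filter {α : Type*} [MeasurableSpace α] {n : ℕ} (p : α → Fin n → Prop)
    [∀ x, DecidablePred (p x)] (hp : ∀ i, MeasurableSet {x | p x i}) :
    Measurable fun x => (Finset.univ.filter (p x)).card := by
  classical
  simp only [Finset.card_filter]
  exact Finset.measurable_sum _ fun i _ =>
    Measurable.ite (hp i) measurable_const measurable_const

theorem measurable_signCounts {n : ℕ} : Measurable (signCounts (n := n)) :=
  (measurable_card_filter (fun (z : Fin n → ℝ) i => z i < 0) fun i =>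
    measurableSet_lt (measurable_pi_apply i) measurable_const).prodMk
  (measurable_card_filter (fun (z : Fin n → ℝ) i => 0 < z i) fun i =>
    measurableSet_lt measurable_const (measurable_pi_apply i))

theorem measurable_orderStat {n : ℕ} : Measurable (orderStat (n := n)) := by
  refine measurable_pi_lambda _ fun i => measurable_of_Iic fun t => ?_
  have key : (fun z : Fin n → ℝ => orderStat z i) ⁻¹' Iic t =
      {z | (i : ℕ) < (Finset.univ.filter fun j => z j ≤ t).card} := by
    ext z
    have h1 := Tuple.lt_card_le_iff_apply_le_of_monotone (f := orderStat z) (a := t) (j := i)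
      (Tuple.monotone_sort z)
    have h2 : (Finset.univ.filter fun j => orderStat z j ≤ t).card =
        (Finset.univ.filter fun j => z j ≤ t).card := by
      refine Finset.card_bij (fun j _ => Tuple.sort z j) ?_ ?_ ?_
      · intro j hj
        exact Finset.mem_filter.2 ⟨Finset.mem_univ _, (Finset.mem_filter.1 hj).2⟩
      · intro j _ k _ h
        exact (Tuple.sort z).injective h
      · intro j hj
        refine ⟨(Tuple.sort z).symm j, Finset.mem_filter.2 ⟨Finset.mem_univ _, ?_⟩, by simp⟩
        simpa [orderStat] using (Finset.mem_filter.1 hj).2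
    rw [h2] at h1
    simpa using h1.symm
  rw [key]
  exact measurableSet_lt measurable_const
    (measurable_card_filter (fun (z : Fin n → ℝ) j => z j ≤ t) fun j =>
      measurableSet_le (measurable_pi_apply j) measurable_const)

/-- `σ(N)` is a sub-σ-algebra of the Borel σ-algebra (so that conditioning on it is meaningful). -/
theorem sigmaCounts_le (n : ℕ) : sigmaCounts n ≤ MeasurableSpace.pi :=
  measurable_signCounts.comap_le

/-- The σ-algebra of the order statistics is a sub-σ-algebra of the Borel σ-algebra. -/
theorem sigmaOrder_le (n : ℕ) : sigmaOrder n ≤ MeasurableSpace.pi :=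
  measurable_orderStat.comap_le

/-! ### Stochastic order symbols -/

/-- `X n = o_P(r n)` as `n → ∞`, where `X n` is a random variable under `P n`. -/
def IsLittleOInProb {Ω : ℕ → Type*} [∀ n, MeasurableSpace (Ω n)] (P : ∀ n, Measure (Ω n))
    (X : ∀ n, Ω n → ℝ) (r : ℕ → ℝ) : Prop :=
  ∀ ε : ℝ, 0 < ε → Tendsto (fun n => P n {ω | ε * r n < |X n ω|}) atTop (𝓝 0)

/-! ### Scores, regression constants and statistics -/

/-- A sequence of score functions: `a n ν η i` is the value of the `n`-th score function at
`((ν, η); i)`.  It is only ever evaluated for `ν, η ∈ {0, …, n}`, `η ≤ n - ν`, `i ∈ {1, …, n}`. -/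
abbrev Scores : Type := ℕ → ℕ → ℕ → ℕ → ℝ

/-- A triangular array of regression constants. -/
abbrev RegConstants : Type := (n : ℕ) → Fin n → ℝ

/-- The score `a(N; R_i)`. -/
def score (a : Scores) {n : ℕ} (i : Fin n) (z : Fin n → ℝ) : ℝ :=
  a n (numNeg z) (numPos z) (rank z i)

/-- The mean of the `n`-th row of regression constants. -/
def cBar (c : RegConstants) (n : ℕ) : ℝ :=
  (∑ i, c n i) / n

/-- The sum of squared deviations `∑ᵢ (cᵢ - c̄)²`. -/
def sumSq (c : RegConstants) (n : ℕ) : ℝ :=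
  ∑ i, (c n i - cBar c n) ^ 2

/-- The Noether condition.  (A row with fewer than two constants has all its constants equal, so
"not all equal" is required of all sufficiently long rows.) -/
structure NoetherCondition (c : RegConstants) : Prop where
  not_all_equal : ∀ᶠ n in atTop, ∃ i j : Fin n, c n i ≠ c n j
  tendsto_zero :
    Tendsto (fun n => (⨆ i : Fin n, (c n i - cBar c n) ^ 2) / sumSq c n) atTop (𝓝 0)

/-- The linear nonserial sign-and-rank statistic `S_c = n⁻¹ ∑ᵢ cᵢ a(N; Rᵢ)`. -/
def signRankStat (c : RegConstants) (a : Scores) (n : ℕ) (z : Fin n → ℝ) : ℝ :=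
  (1 / n) * ∑ i, c n i * score a i z

/-- The parametric statistic `T_{φ;f} = n⁻¹ ∑ᵢ cᵢ φ(F(Zᵢ))`. -/
def paramStat (c : RegConstants) (φ : ℝ → ℝ) (f : ZeroMedianDensity) (n : ℕ)
    (z : Fin n → ℝ) : ℝ :=
  (1 / n) * ∑ i, c n i * φ (f.distFun (z i))

/-- The function `φ` on `(0, 1)` is a score-generating function for `a` (under density `f`):
`E[(a(N; R₁) - φ(F(Z₁)))² | Z₍·₎] = o_P(1)`.  The sample size is written `n + 1`, because `Z₁`
exists only in a nonempty sample. -/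
def IsScoreGenerating (f : ZeroMedianDensity) (φ : ℝ → ℝ) (a : Scores) : Prop :=
  IsLittleOInProb (fun n => f.whiteNoise (n + 1))
    (fun n => (f.whiteNoise (n + 1))[
      (fun z => (score a 0 z - φ (f.distFun (z 0))) ^ 2) | sigmaOrder (n + 1)])
    (fun _ => 1)

/-- `σ²_φ = ∫₀¹ φ² - (∫₀¹ φ)²`. -/
def scoreVariance (φ : ℝ → ℝ) : ℝ :=
  (∫ u in Ioo (0 : ℝ) 1, φ u ^ 2) - (∫ u in Ioo (0 : ℝ) 1, φ u) ^ 2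

end SignRank

end

open SignRank

/-! Exchangeability reduces both conditional centrings to one operation. If variables are permuted
along with the sample and their sum is measurable for a σ-algebra of symmetric events, conditioning
replaces each of them by their average (`condExp_sum_mul_ae_eq`). The order statistics determine the
sum of the `φ(F(Zᵢ))`. Without ties the scores add up to `∑ₖ a(N; k)`, so `N` determines their sum.
Hence each conditional centring merely replaces `cᵢ` by `cᵢ - c̄`.

The two sides of (i) therefore differ by a centred combination of the score errors, whose empirical
second moment is exactly the conditional expectation assumed to be `o_P(1)`. On the symmetric event
where that moment is at most `δ`, the Gram matrix of the errors is permutation invariant. Its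
quadratic form at a centred vector is then at most `2δ` times the squared norm, and Chebyshev's
inequality concludes (`isLittleOInProb_sum_mul`).

For (ii), the parametric sum is compared factor by factor with a Gaussian characteristic function,
and the negligible error transfers the limit to the scores. Signs and ranks survive the
transformation by `F`, so the law of the statistic is the same under every `g`. -/

namespace SignRank

/-! ### Exchangeable families and their centred linear combinations -/

section Exchangeable

variable {α : Type*} {n : ℕ}

/-- A family of statistics that is permuted along with the coordinates of the sample. -/
def Equivariant (X : Fin n → (Fin n → α) → ℝ) : Prop :=
  ∀ (σ : Equiv.Perm (Fin n)) i z, X i (z ∘ σ) = X (σ i) z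

theorem Equivariant.sub {X Y : Fin n → (Fin n → α) → ℝ} (hX : Equivariant X)
    (hY : Equivariant Y) : Equivariant fun i z => X i z - Y i z := fun σ i z => by
  simp only [hX σ i z, hY σ i z]

theorem Equivariant.sq {X : Fin n → (Fin n → α) → ℝ} (hX : Equivariant X) :
    Equivariant fun i z => X i z ^ 2 := fun σ i z => by simp only [hX σ i z]

theorem Equivariant.sum_comp {X : Fin n → (Fin n → α) → ℝ} (hX : Equivariant X)
    (σ : Equiv.Perm (Fin n)) (z : Fin n → α) : ∑ i, X i (z ∘ σ) = ∑ i, X i z := by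
  simp only [hX σ _ z]
  exact Equiv.sum_comp σ fun i => X i z

variable [MeasurableSpace α]

/-- A product of identical σ-finite measures is invariant under permutations of coordinates. -/
theorem measurePreserving_comp_perm (μ : Measure α) [SigmaFinite μ] (σ : Equiv.Perm (Fin n)) :
    MeasurePreserving (fun z : Fin n → α => z ∘ σ)
      (Measure.pi fun _ => μ) (Measure.pi fun _ => μ) where
  measurable := by fun_prop
  map_eq := by
    refine (Measure.pi_eq fun s hs => ?_).symm
    have h : (fun z : Fin n → α => z ∘ σ) ⁻¹' (univ.pi s) = univ.pi fun i => s (σ.symm i) := by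
      ext z
      simp only [mem_preimage, mem_univ_pi, Function.comp_apply]
      exact ⟨fun h i => by simpa using h (σ.symm i), fun h i => by simpa using h (σ i)⟩
    rw [Measure.map_apply (by fun_prop) (MeasurableSet.univ_pi hs), h, Measure.pi_pi]
    exact Equiv.prod_comp σ.symm fun i => μ (s i)

/-- Permuting coordinates is a measurable equivalence, so the change of variables needs no
measurability of `A` or `G`. This matters for events and variables controlled only up to null sets.
-/
theorem setIntegral_comp_perm (μ : Measure α) [SigmaFinite μ] (σ : Equiv.Perm (Fin n))
    {A : Set (Fin n → α)} (hA : (fun z => z ∘ σ) ⁻¹' A = A) (G : (Fin n → α) → ℝ) :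
    ∫ z in A, G (z ∘ σ) ∂(Measure.pi fun _ => μ) = ∫ z in A, G z ∂(Measure.pi fun _ => μ) := by
  let e : (Fin n → α) ≃ᵐ (Fin n → α) :=
    { toFun := fun z => z ∘ σ
      invFun := fun z => z ∘ σ.symm
      left_inv := fun z => by ext i; simp
      right_inv := fun z => by ext i; simp
      measurable_toFun := by simp only [Equiv.coe_fn_mk]; fun_prop
      measurable_invFun := by simp only [Equiv.coe_fn_symm_mk]; fun_prop }
  have h := (measurePreserving_comp_perm μ σ).setIntegral_preimage_emb e.measurableEmbedding G A
  rwa [hA] at h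

/-- Conditional expectation of a linear combination of exchangeable variables given a σ-algebra
of symmetric events that makes their sum measurable. -/
theorem condExp_sum_mul_ae_eq (μ : Measure α) [IsProbabilityMeasure μ]
    {m : MeasurableSpace (Fin n → α)} (hm : m ≤ MeasurableSpace.pi)
    (hsymm : ∀ s, MeasurableSet[m] s → ∀ σ : Equiv.Perm (Fin n), (fun z => z ∘ σ) ⁻¹' s = s)
    {X : Fin n → (Fin n → α) → ℝ} (hX : Equivariant X)
    (hint : ∀ i, Integrable (X i) (Measure.pi fun _ => μ))
    (hmeas : AEStronglyMeasurable[m] (fun z => ∑ i, X i z) (Measure.pi fun _ => μ))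
    (w : Fin n → ℝ) :
    (Measure.pi fun _ => μ)[fun z => ∑ i, w i * X i z | m] =ᵐ[Measure.pi fun _ => μ]
      fun z => (∑ i, w i) / n * ∑ i, X i z := by
  rcases Nat.eq_zero_or_pos n with rfl | hn
  · simp only [Finset.univ_eq_empty, Finset.sum_empty, zero_div, zero_mul]
    rw [show (fun _ : Fin 0 → α => (0 : ℝ)) = 0 from rfl, condExp_zero]
  have hn' : (n : ℝ) ≠ 0 := by positivity
  let i₀ : Fin n := ⟨0, hn⟩
  refine (ae_eq_condExp_of_forall_setIntegral_eq hm ?_ ?_ ?_ ?_).symm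
  · exact integrable_finsetSum _ fun i _ => (hint i).const_mul _
  · exact fun s _ _ => ((integrable_finsetSum _ fun i _ => hint i).const_mul _).integrableOn
  · intro s hs _
    -- A transposition fixes the symmetric event `s` and exchanges the variables, so all of them
    -- have the same integral over `s`.
    have hsame : ∀ i, ∫ z in s, X i z ∂(Measure.pi fun _ => μ)
        = ∫ z in s, X i₀ z ∂(Measure.pi fun _ => μ) := fun i => by
      rw [← setIntegral_comp_perm μ (Equiv.swap i₀ i) (hsymm s hs _) (X i₀)]
      simp only [hX _ i₀, Equiv.swap_apply_left]
    rw [integral_const_mul, integral_finsetSum _ fun i _ => (hint i).integrableOn,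
      integral_finsetSum _ fun i _ => ((hint i).const_mul _).integrableOn]
    simp only [integral_const_mul, hsame, Finset.sum_const, Finset.card_univ, Fintype.card_fin,
      nsmul_eq_mul, ← Finset.sum_mul]
    field_simp
  · exact hmeas.const_mul _

/-- Bound for the quadratic form of a permutation-invariant matrix at a centred vector. -/
theorem quadraticForm_le_of_perm_invariant {M : Fin n → Fin n → ℝ}
    (hM : ∀ (σ : Equiv.Perm (Fin n)) i j, M (σ i) (σ j) = M i j)
    (hle : ∀ i j, |M i j| ≤ (M i i + M j j) / 2) (i₀ : Fin n)
    {w : Fin n → ℝ} (hw : ∑ i, w i = 0) :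
    ∑ i, ∑ j, w i * w j * M i j ≤ 2 * M i₀ i₀ * ∑ i, w i ^ 2 := by
  have hdiag : ∀ i, M i i = M i₀ i₀ := fun i => by
    rw [← hM (Equiv.swap i i₀) i i, Equiv.swap_apply_left]
  -- The permutation group is transitive on ordered pairs of distinct indices, so the off-diagonal
  -- entries share one value `q`. Only its lower bound matters; with a single index there is no such
  -- entry and the diagonal value serves.
  obtain ⟨q, hq, hoff⟩ : ∃ q, -M i₀ i₀ ≤ q ∧ ∀ i j, i ≠ j → M i j = q := by
    by_cases h : ∃ a b : Fin n, a ≠ b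
    · obtain ⟨a, b, hab⟩ := h
      refine ⟨M a b, ?_, fun i j hij => ?_⟩
      · have := hle a b
        rw [hdiag a, hdiag b] at this
        linarith [neg_abs_le (M a b)]
      · obtain ⟨σ, hσ⟩ : ∃ σ : Equiv.Perm (Fin n), σ a = i ∧ σ b = j := by
          -- The first transposition takes `a` to `i`; the second moves the image of `b` to `j`
          -- without disturbing `i`.
          refine ⟨(Equiv.swap a i).trans (Equiv.swap (Equiv.swap a i b) j), ?_, ?_⟩
          · rw [Equiv.trans_apply, Equiv.swap_apply_left]
            refine Equiv.swap_apply_of_ne_of_ne (fun h => hab ?_) hij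
            rw [Equiv.swap_apply_eq_iff.1 h.symm]
            simp
          · simp
        rw [← hM σ a b, hσ.1, hσ.2]
    · push Not at h
      have := hle i₀ i₀
      exact ⟨M i₀ i₀, by linarith [abs_nonneg (M i₀ i₀)], fun i j hij => absurd (h i j) hij⟩
  -- The constant part `q` of the matrix is annihilated by the centred vector, leaving a multiple of
  -- the identity.
  have hrow : ∀ i, ∑ j, w i * w j * M i j = (M i₀ i₀ - q) * w i ^ 2 := fun i => by
    have : ∀ j, w i * w j * M i j
        = q * w i * w j + if i = j then (M i₀ i₀ - q) * w i ^ 2 else 0 := fun j => by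
      split_ifs with h
      · subst h; rw [hdiag]; ring
      · rw [hoff i j h]; ring
    simp only [this, Finset.sum_add_distrib, ← Finset.mul_sum, hw, Finset.sum_ite_eq,
      Finset.mem_univ, if_true]
    ring
  simp only [hrow, ← Finset.mul_sum]
  have : 0 ≤ ∑ i, w i ^ 2 := Finset.sum_nonneg fun i _ => sq_nonneg _
  nlinarith

/-- Second-moment bound, on an event bounding the empirical second moment, for a centred linear
combination of exchangeable variables. -/
theorem setIntegral_sq_sum_le (μ : Measure α) [IsProbabilityMeasure μ]
    {d : Fin n → (Fin n → α) → ℝ} (hd : Equivariant d)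
    (hL2 : ∀ i, MemLp (d i) 2 (Measure.pi fun _ => μ)) (hn : 0 < n)
    {A : Set (Fin n → α)} (hA : ∀ σ : Equiv.Perm (Fin n), (fun z => z ∘ σ) ⁻¹' A = A)
    (hAm : NullMeasurableSet A (Measure.pi fun _ => μ))
    {δ : ℝ} (hAδ : ∀ z ∈ A, 1 / n * ∑ i, d i z ^ 2 ≤ δ) (hδ : 0 ≤ δ)
    {w : Fin n → ℝ} (hw : ∑ i, w i = 0) :
    ∫ z in A, (∑ i, w i * d i z) ^ 2 ∂(Measure.pi fun _ => μ) ≤ 2 * δ * ∑ i, w i ^ 2 := by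
  set P : Measure (Fin n → α) := Measure.pi fun _ => μ
  have hn' : (0 : ℝ) < n := by exact_mod_cast hn
  let i₀ : Fin n := ⟨0, hn⟩
  have hint : ∀ i j, Integrable (fun z => d i z * d j z) P := fun i j =>
    (hL2 i).integrable_mul (hL2 j)
  let M : Fin n → Fin n → ℝ := fun i j => ∫ z in A, d i z * d j z ∂P
  have hMσ : ∀ (σ : Equiv.Perm (Fin n)) i j, M (σ i) (σ j) = M i j := fun σ i j => by
    have := setIntegral_comp_perm μ σ (hA σ) fun z => d i z * d j z
    simp only [hd σ] at this
    exact this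
  have hMle : ∀ i j, |M i j| ≤ (M i i + M j j) / 2 := fun i j => by
    have h1 : ∫ z in A, (d i z * d i z + d j z * d j z) / 2 ∂P = (M i i + M j j) / 2 := by
      rw [integral_div, integral_add (hint i i).integrableOn (hint j j).integrableOn]
    rw [← h1]
    refine (abs_integral_le_integral_abs).trans
      (integral_mono (hint i j).integrableOn.abs
        (((hint i i).add (hint j j)).div_const 2).integrableOn fun z => ?_)
    simp only
    rw [abs_le]
    constructor <;> nlinarith [sq_nonneg (d i z + d j z), sq_nonneg (d i z - d j z)]
  have hexp : ∫ z in A, (∑ i, w i * d i z) ^ 2 ∂P = ∑ i, ∑ j, w i * w j * M i j := by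
    have : ∀ z, (∑ i, w i * d i z) ^ 2 = ∑ i, ∑ j, w i * w j * (d i z * d j z) := fun z => by
      rw [sq, Finset.sum_mul_sum]
      exact Finset.sum_congr rfl fun i _ => Finset.sum_congr rfl fun j _ => by ring
    simp only [this]
    rw [integral_finsetSum _ fun i _ => integrable_finsetSum _ fun j _ =>
      ((hint i j).const_mul _).integrableOn]
    refine Finset.sum_congr rfl fun i _ => ?_
    rw [integral_finsetSum _ fun j _ => ((hint i j).const_mul _).integrableOn]
    exact Finset.sum_congr rfl fun j _ => integral_const_mul _ _
  have hdiag : M i₀ i₀ ≤ δ := by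
    have hsame : ∀ i, M i i = M i₀ i₀ := fun i => by
      rw [← hMσ (Equiv.swap i i₀) i i, Equiv.swap_apply_left]
    -- The common diagonal entry is the average of the diagonal, that is, the integral over `A` of
    -- the empirical second moment.
    have h1 : ∫ z in A, 1 / n * ∑ i, d i z ^ 2 ∂P = M i₀ i₀ := by
      simp only [sq]
      rw [integral_const_mul, integral_finsetSum _ fun i _ => (hint i i).integrableOn]
      change 1 / (n : ℝ) * ∑ i, M i i = _
      simp only [hsame, Finset.sum_const, Finset.card_univ, Fintype.card_fin, nsmul_eq_mul]
      field_simp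
    rw [← h1]
    calc ∫ z in A, 1 / n * ∑ i, d i z ^ 2 ∂P ≤ ∫ z in A, δ ∂P := by
          refine setIntegral_mono_on₀ ?_ integrableOn_const hAm hAδ
          simp only [sq]
          exact ((integrable_finsetSum _ fun i _ => hint i i).const_mul _).integrableOn
      _ ≤ δ := by
          rw [setIntegral_const, smul_eq_mul]
          exact mul_le_of_le_one_left hδ measureReal_le_one
  rw [hexp]
  refine (quadraticForm_le_of_perm_invariant hMσ hMle i₀ hw).trans ?_
  have : 0 ≤ ∑ i, w i ^ 2 := Finset.sum_nonneg fun i _ => sq_nonneg _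
  gcongr

/-- A centred linear combination of exchangeable variables with bounded weights is negligible as
soon as the empirical second moment is. -/
theorem isLittleOInProb_sum_mul (μ : Measure α) [IsProbabilityMeasure μ]
    {d : ∀ n, Fin n → (Fin n → α) → ℝ} (hd : ∀ n, Equivariant (d n))
    (hL2 : ∀ n i, MemLp (d n i) 2 (Measure.pi fun _ => μ))
    (hQ : IsLittleOInProb (fun n => Measure.pi fun _ : Fin n => μ)
      (fun n z => 1 / n * ∑ i, d n i z ^ 2) fun _ => 1)
    {w : ∀ n, Fin n → ℝ} (hw : ∀ᶠ n in atTop, ∑ i, w n i = 0)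
    {C : ℝ} (hC : ∀ᶠ n in atTop, ∑ i, w n i ^ 2 ≤ C) :
    IsLittleOInProb (fun n => Measure.pi fun _ : Fin n => μ)
      (fun n z => ∑ i, w n i * d n i z) fun _ => 1 := by
  intro ε hε
  have hC0 : 0 ≤ C := by
    obtain ⟨n, hn⟩ := hC.exists
    exact (Finset.sum_nonneg fun i _ => sq_nonneg _).trans hn
  rw [ENNReal.tendsto_nhds_zero]
  intro η hη
  -- Half of `η` goes to the complement of the truncation event and half to Chebyshev's inequality;
  -- `η` may be infinite.
  obtain ⟨κ, hκ, hκη⟩ : ∃ κ : ℝ, 0 < κ ∧ ENNReal.ofReal κ + ENNReal.ofReal κ ≤ η := by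
    rcases eq_or_ne η ∞ with rfl | h
    · exact ⟨1, one_pos, le_top⟩
    · have := ENNReal.toReal_pos hη.ne' h
      refine ⟨η.toReal / 2, by positivity, ?_⟩
      rw [← ENNReal.ofReal_add (by positivity) (by positivity), add_halves, ENNReal.ofReal_toReal h]
  -- Makes the Chebyshev bound `2δC / ε²` at most `κ`; `C + 1` guards against `C = 0`.
  set δ : ℝ := κ * ε ^ 2 / (2 * (C + 1)) with hδ
  have hδ0 : 0 < δ := by positivity
  filter_upwards [hw, hC, eventually_gt_atTop 0, ENNReal.tendsto_nhds_zero.1 (hQ δ hδ0)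
    (ENNReal.ofReal κ) (by simpa using hκ)] with n hwn hCn hn hQn
  refine le_trans ?_ hκη
  simp only [mul_one] at hQn ⊢
  set P : Measure (Fin n → α) := Measure.pi fun _ => μ
  set Q : (Fin n → α) → ℝ := fun z => 1 / n * ∑ i, d n i z ^ 2 with hQdef
  have hQ0 : ∀ z, 0 ≤ Q z := fun z =>
    mul_nonneg (by positivity) (Finset.sum_nonneg fun i _ => sq_nonneg _)
  -- Convergence in probability gives no control of expectations, so second moments are taken only
  -- on this event; it is symmetric because `Q` is.
  set A : Set (Fin n → α) := {z | Q z ≤ δ} with hA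
  have hQm : AEMeasurable Q P := by
    refine AEMeasurable.const_mul (Finset.aemeasurable_fun_sum _ fun i _ => ?_) _
    exact (hL2 n i).aestronglyMeasurable.aemeasurable.pow_const 2
  have hAm : NullMeasurableSet A P := nullMeasurableSet_le hQm aemeasurable_const
  have hAσ : ∀ σ : Equiv.Perm (Fin n), (fun z => z ∘ σ) ⁻¹' A = A := fun σ => by
    ext z
    simp only [hA, hQdef, mem_preimage, mem_ofPred_eq, (hd n).sq.sum_comp σ z]
  have hbd := setIntegral_sq_sum_le μ (hd n) (hL2 n) hn hAσ hAm (fun z hz => hz) hδ0.le hwn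
  set Y : (Fin n → α) → ℝ := fun z => ∑ i, w n i * d n i z with hY
  have hYm : AEMeasurable Y P := Finset.aemeasurable_fun_sum _ fun i _ =>
    (hL2 n i).aestronglyMeasurable.aemeasurable.const_mul _
  have hYL2 : MemLp Y 2 P := memLp_finsetSum _ fun i _ => (hL2 n i).const_mul _
  have hcheb : (P.restrict A) {z | ε < |Y z|} ≤ ENNReal.ofReal κ := by
    have h1 := mul_meas_ge_le_integral_of_nonneg (μ := P.restrict A) (f := fun z => Y z ^ 2)
      (ae_of_all _ fun z => sq_nonneg _) hYL2.integrable_sq.integrableOn (ε ^ 2)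
    have h2 : (P.restrict A).real {z | ε ^ 2 ≤ Y z ^ 2} ≤ κ := by
      have h3 : ε ^ 2 * (P.restrict A).real {z | ε ^ 2 ≤ Y z ^ 2} ≤ ε ^ 2 * κ := by
        refine h1.trans (hbd.trans ?_)
        calc 2 * δ * ∑ i, w n i ^ 2 ≤ 2 * δ * (C + 1) := by gcongr; linarith
          _ = ε ^ 2 * κ := by rw [hδ]; field_simp
      exact le_of_mul_le_mul_left h3 (by positivity)
    calc (P.restrict A) {z | ε < |Y z|} ≤ (P.restrict A) {z | ε ^ 2 ≤ Y z ^ 2} := by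
          refine measure_mono fun z hz => ?_
          simp only [mem_ofPred_eq] at hz ⊢
          rw [← sq_abs (Y z)]
          gcongr
      _ = ENNReal.ofReal ((P.restrict A).real {z | ε ^ 2 ≤ Y z ^ 2}) :=
          (ofReal_measureReal).symm
      _ ≤ ENNReal.ofReal κ := ENNReal.ofReal_le_ofReal h2
  calc P {z | ε < |Y z|} ≤ P (({z | ε < |Y z|} ∩ A) ∪ {z | δ < |Q z|}) := by
        refine measure_mono fun z hz => ?_
        by_cases h : z ∈ A
        · exact Or.inl ⟨hz, h⟩
        · refine Or.inr ?_
          rw [mem_ofPred_eq, abs_of_nonneg (hQ0 z)]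
          exact not_le.1 h
    _ ≤ P ({z | ε < |Y z|} ∩ A) + P {z | δ < |Q z|} := measure_union_le _ _
    _ ≤ ENNReal.ofReal κ + ENNReal.ofReal κ := by
        gcongr
        rwa [Measure.restrict_apply₀' hAm] at hcheb

end Exchangeable

/-! ### Central limit theorem for weighted sums by characteristic functions -/

section CentralLimit

/-- Telescoping: factors are exchanged one at a time, and the remaining ones have modulus at most
one. -/
theorem norm_prod_sub_prod_le {ι : Type*} (s : Finset ι) (a b : ι → ℂ)
    (ha : ∀ i ∈ s, ‖a i‖ ≤ 1) (hb : ∀ i ∈ s, ‖b i‖ ≤ 1) :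
    ‖∏ i ∈ s, a i - ∏ i ∈ s, b i‖ ≤ ∑ i ∈ s, ‖a i - b i‖ := by
  classical
  induction s using Finset.induction_on with
  | empty => simp
  | insert i s hi ih =>
    rw [Finset.prod_insert hi, Finset.prod_insert hi, Finset.sum_insert hi]
    have hP : ‖∏ j ∈ s, b j‖ ≤ 1 := by
      rw [norm_prod]
      exact Finset.prod_le_one (fun _ _ => norm_nonneg _)
        fun j hj => hb j (Finset.mem_insert_of_mem hj)
    have e : a i * ∏ j ∈ s, a j - b i * ∏ j ∈ s, b j
        = a i * (∏ j ∈ s, a j - ∏ j ∈ s, b j) + (a i - b i) * ∏ j ∈ s, b j := by ring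
    rw [e]
    refine (norm_add_le _ _).trans ?_
    rw [norm_mul, norm_mul, add_comm]
    refine add_le_add (mul_le_of_le_one_right (norm_nonneg _) hP) ?_
    refine (mul_le_of_le_one_left (norm_nonneg _) (ha i (Finset.mem_insert_self _ _))).trans ?_
    exact ih (fun j hj => ha j (Finset.mem_insert_of_mem hj))
      fun j hj => hb j (Finset.mem_insert_of_mem hj)

/-- The characteristic function of a standardized variable agrees with that of the standard
normal law up to `o(t²)` at the origin. -/
theorem charFun_sub_charFun_gaussian_isLittleO {Ω : Type*} [MeasurableSpace Ω] {P : Measure Ω}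
    [IsProbabilityMeasure P] {X : Ω → ℝ} (hX : AEMeasurable X P) (h0 : P[X] = 0)
    (h1 : P[X ^ 2] = 1) :
    (fun t : ℝ => charFun (P.map X) t - charFun (gaussianReal 0 1) t) =o[𝓝 0]
      fun t : ℝ => t ^ 2 := by
  -- The standard normal law has the same second-order expansion, so the quadratic parts cancel.
  have hg := taylor_charFun_two (P := gaussianReal 0 1) (X := id) aemeasurable_id
    (by simp) (by
      have := variance_id_gaussianReal (μ := 0) (v := 1)
      rw [variance_of_integral_eq_zero aemeasurable_id (by simp)] at this
      simpa using this)
  rw [Measure.map_id] at hg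
  refine ((taylor_charFun_two hX h0 h1).sub hg).congr_left fun t => ?_
  ring

/-- Characteristic function of a weighted sum over an i.i.d. sample. -/
theorem charFun_map_sum_mul {α : Type*} [MeasurableSpace α] {n : ℕ} (μ : Measure α)
    [IsProbabilityMeasure μ] {X : α → ℝ} (hX : AEMeasurable X μ) (v : Fin n → ℝ) (t : ℝ) :
    charFun ((Measure.pi fun _ => μ).map fun z : Fin n → α => ∑ i, v i * X (z i)) t
      = ∏ i, charFun (μ.map X) (v i * t) := by
  have hvX : ∀ i, AEMeasurable (fun x => v i * X x) μ := fun i => hX.const_mul _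
  have : ∀ i, IsProbabilityMeasure (μ.map fun x => v i * X x) := fun i =>
    Measure.isProbabilityMeasure_map (hvX i)
  have h1 := Measure.pi_map_pi (μ := fun _ : Fin n => μ) (f := fun i x => v i * X x) hvX
  have h2 := charFun_map_sum_pi_eq_prod fun i => μ.map fun x => v i * X x
  rw [← h1, AEMeasurable.map_map_of_aemeasurable (by fun_prop)] at h2
  · change charFun (Measure.map ((fun p : Fin n → ℝ => ∑ i, p i) ∘
      fun z : Fin n → α => fun i => v i * X (z i)) _) t = _
    rw [h2, Finset.prod_apply]
    exact Finset.prod_congr rfl fun i _ => charFun_map_mul_comp (μ := μ) hX (v i) t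
  · exact aemeasurable_pi_lambda _ fun i =>
      (hvX i).comp_quasiMeasurePreserving (Measure.quasiMeasurePreserving_eval _ i)

/-- The Gaussian limit factors along the weights because their squares sum to `s`. Each factor
differs from its Gaussian counterpart by `o(vᵢ² t²)`, uniformly in `i` since the largest weight
tends to zero, so the total error is `o(1) · s t²`. -/
theorem tendsto_charFun_weighted_sum_standardized {α : Type*} [MeasurableSpace α] (μ : Measure α)
    [IsProbabilityMeasure μ] {X : α → ℝ} (hX : AEMeasurable X μ) (h0 : μ[X] = 0)
    (h1 : μ[X ^ 2] = 1) {v : ∀ n, Fin n → ℝ} {s : ℝ}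
    (hs : ∀ᶠ n in atTop, ∑ i, v n i ^ 2 = s)
    (hmax : ∀ ε > 0, ∀ᶠ n in atTop, ∀ i, |v n i| < ε) (t : ℝ) :
    Tendsto (fun n => charFun ((Measure.pi fun _ => μ).map
      fun z : Fin n → α => ∑ i, v n i * X (z i)) t) atTop
      (𝓝 (Complex.exp (-(s * t ^ 2 / 2 : ℝ)))) := by
  have hs0 : 0 ≤ s := by
    obtain ⟨n, hn⟩ := hs.exists
    exact hn ▸ Finset.sum_nonneg fun i _ => sq_nonneg _
  have : IsProbabilityMeasure (μ.map X) := Measure.isProbabilityMeasure_map hX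
  rw [Metric.tendsto_nhds]
  intro ε hε
  -- The errors will add up to this constant times `t² s`, hence to less than `ε`.
  have hc : 0 < ε / (t ^ 2 * s + 1) := by positivity
  have hsmall := (charFun_sub_charFun_gaussian_isLittleO hX h0 h1).bound hc
  obtain ⟨δ, hδ, hball⟩ := Metric.eventually_nhds_iff.1 hsmall
  filter_upwards [hs, hmax (δ / (|t| + 1)) (by positivity)] with n hsn hmn
  have hprod : Complex.exp (-(s * t ^ 2 / 2 : ℝ))
      = ∏ i, charFun (gaussianReal 0 1) (v n i * t) := by
    simp only [charFun_gaussianReal, ← Complex.exp_sum]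
    congr 1
    rw [← hsn]
    push_cast
    rw [Finset.sum_mul, Finset.sum_div, ← Finset.sum_neg_distrib]
    exact Finset.sum_congr rfl fun i _ => by simp; ring
  rw [hprod, charFun_map_sum_mul μ hX, dist_eq_norm]
  refine (norm_prod_sub_prod_le _ _ _ (fun i _ => norm_charFun_le_one _)
    fun i _ => norm_charFun_le_one _).trans_lt ?_
  have hterm : ∀ i, ‖charFun (μ.map X) (v n i * t) - charFun (gaussianReal 0 1) (v n i * t)‖
      ≤ ε / (t ^ 2 * s + 1) * (t ^ 2 * v n i ^ 2) := fun i => by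
    have hlt : dist (v n i * t) 0 < δ := by
      rw [dist_zero_right, Real.norm_eq_abs, abs_mul]
      calc |v n i| * |t| ≤ |v n i| * (|t| + 1) := by gcongr; linarith
        _ < δ / (|t| + 1) * (|t| + 1) := by gcongr; exact hmn i
        _ = δ := by field_simp
    refine (hball hlt).trans_eq ?_
    rw [Real.norm_of_nonneg (sq_nonneg _)]
    ring
  calc _ ≤ ∑ i, ε / (t ^ 2 * s + 1) * (t ^ 2 * v n i ^ 2) := Finset.sum_le_sum fun i _ => hterm i
    _ = ε * (t ^ 2 * s / (t ^ 2 * s + 1)) := by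
        rw [← Finset.mul_sum, ← Finset.mul_sum, hsn]; ring
    _ < ε * 1 := by
        gcongr
        rw [div_lt_one (by positivity)]
        linarith
    _ = ε := mul_one ε

/-- Central limit theorem for centred weighted sums under the Noether condition, in terms of
characteristic functions. -/
theorem tendsto_charFun_weighted_sum {α : Type*} [MeasurableSpace α] (μ : Measure α)
    [IsProbabilityMeasure μ] {ψ : α → ℝ} (hψ : MemLp ψ 2 μ) (hvar : 0 < variance ψ μ)
    {w : ∀ n, Fin n → ℝ} (hw0 : ∀ᶠ n in atTop, ∑ i, w n i = 0)
    (hw1 : ∀ᶠ n in atTop, ∑ i, w n i ^ 2 = 1)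
    (hmax : ∀ ε > 0, ∀ᶠ n in atTop, ∀ i, |w n i| < ε) (t : ℝ) :
    Tendsto (fun n => charFun ((Measure.pi fun _ => μ).map
      fun z : Fin n → α => ∑ i, w n i * ψ (z i)) t) atTop
      (𝓝 (Complex.exp (-(variance ψ μ * t ^ 2 / 2 : ℝ)))) := by
  set V := variance ψ μ with hV
  set m := μ[ψ] with hm
  have hsq : 0 < √V := Real.sqrt_pos.2 hvar
  have hsqV : √V ^ 2 = V := Real.sq_sqrt hvar.le
  let X : α → ℝ := fun x => (ψ x - m) / √V
  have hψi : Integrable ψ μ := hψ.integrable one_le_two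
  have hX : AEMeasurable X μ := by
    have := hψ.aestronglyMeasurable.aemeasurable
    fun_prop
  have h0 : μ[X] = 0 := by
    simp only [X]
    rw [integral_div, integral_sub hψi (integrable_const _)]
    simp [hm]
  have h1 : μ[X ^ 2] = 1 := by
    simp only [X, Pi.pow_apply, div_pow, hsqV]
    rw [integral_div, ← variance_eq_integral hψ.aestronglyMeasurable.aemeasurable]
    exact div_self hvar.ne'
  -- Scaling the weights by `√V` compensates for the standardization; the mean drops out because the
  -- weights are centred.
  have key := tendsto_charFun_weighted_sum_standardized μ hX h0 h1
    (v := fun n i => √V * w n i) (s := V) ?_ ?_ t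
  · refine key.congr' ?_
    filter_upwards [hw0] with n hn
    congr 2
    ext z
    have : ∀ i, √V * w n i * X (z i) = w n i * ψ (z i) - w n i * m := fun i => by
      simp only [X]; field_simp
    simp only [this, Finset.sum_sub_distrib, ← Finset.sum_mul, hn]
    ring
  · filter_upwards [hw1] with n hn
    simp only [mul_pow, ← Finset.mul_sum, hn, hsqV, mul_one]
  · intro ε hε
    filter_upwards [hmax (ε / √V) (by positivity)] with n hn i
    rw [abs_mul, abs_of_pos hsq, mul_comm]
    exact (lt_div_iff₀ hsq).1 (hn i)

/-- Variables that differ by a negligible term have characteristic functions with the same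
limit; the underlying probability spaces may vary. -/
theorem tendsto_charFun_of_isLittleOInProb_sub {Ω : ℕ → Type*} [∀ n, MeasurableSpace (Ω n)]
    (P : ∀ n, Measure (Ω n)) [∀ n, IsProbabilityMeasure (P n)] {X Y : ∀ n, Ω n → ℝ}
    (hX : ∀ n, AEMeasurable (X n) (P n)) (hY : ∀ n, AEMeasurable (Y n) (P n))
    (hsub : IsLittleOInProb P (fun n ω => Y n ω - X n ω) fun _ => 1) {t : ℝ} {L : ℂ}
    (hlim : Tendsto (fun n => charFun ((P n).map (X n)) t) atTop (𝓝 L)) :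
    Tendsto (fun n => charFun ((P n).map (Y n)) t) atTop (𝓝 L) := by
  have hcf : ∀ n (Z : Ω n → ℝ), AEMeasurable Z (P n) → charFun ((P n).map Z) t
      = ∫ ω, Complex.exp (t * Z ω * Complex.I) ∂(P n) := fun n Z hZ => by
    rw [charFun_apply_real, integral_map hZ (by fun_prop)]
  have hint : ∀ n (Z : Ω n → ℝ), AEMeasurable Z (P n) →
      Integrable (fun ω => Complex.exp (t * Z ω * Complex.I)) (P n) := fun n Z hZ => by
    refine Integrable.of_bound (C := 1) ?_ (ae_of_all _ fun ω => ?_)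
    · exact AEMeasurable.aestronglyMeasurable (by fun_prop)
    · rw [← Complex.ofReal_mul, Complex.norm_exp_ofReal_mul_I]
  have hdiff : Tendsto (fun n => charFun ((P n).map (Y n)) t - charFun ((P n).map (X n)) t)
      atTop (𝓝 0) := by
    rw [Metric.tendsto_nhds]
    intro ε hε
    set δ := ε / (2 * (|t| + 1)) with hδ
    have hδ0 : 0 < δ := by positivity
    have hreal : Tendsto (fun n => (P n).real {ω | δ < |Y n ω - X n ω|}) atTop (𝓝 0) := by
      have := (ENNReal.tendsto_toReal ENNReal.zero_ne_top).comp (hsub δ hδ0)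
      simp only [mul_one] at this
      exact this
    filter_upwards [hreal.eventually_lt_const (show (0 : ℝ) < ε / 4 by positivity)] with n hn
    set B : Set (Ω n) := {ω | δ < |Y n ω - X n ω|} with hB
    have hBm : NullMeasurableSet B (P n) :=
      nullMeasurableSet_lt aemeasurable_const
        (continuous_abs.measurable.comp_aemeasurable ((hY n).sub (hX n)))
    -- On `B` the trivial bound 2 is used; elsewhere `|exp(ix) - 1| ≤ |x|` applies.
    have hpt : ∀ ω, ‖Complex.exp (t * Y n ω * Complex.I) - Complex.exp (t * X n ω * Complex.I)‖
        ≤ |t| * δ + B.indicator (fun _ => (2 : ℝ)) ω := fun ω => by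
      by_cases hω : ω ∈ B
      · rw [indicator_of_mem hω]
        refine (norm_sub_le _ _).trans ?_
        rw [← Complex.ofReal_mul, ← Complex.ofReal_mul, Complex.norm_exp_ofReal_mul_I,
          Complex.norm_exp_ofReal_mul_I]
        nlinarith [abs_nonneg t]
      · rw [indicator_of_notMem hω, add_zero]
        have e : Complex.exp (t * Y n ω * Complex.I) - Complex.exp (t * X n ω * Complex.I)
            = Complex.exp ((t * X n ω : ℝ) * Complex.I) *
              (Complex.exp (Complex.I * (t * (Y n ω - X n ω) : ℝ)) - 1) := by
          rw [mul_sub, ← Complex.exp_add, mul_one]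
          push_cast
          ring_nf
        rw [e, norm_mul, Complex.norm_exp_ofReal_mul_I, one_mul]
        refine (Real.norm_exp_I_mul_ofReal_sub_one_le).trans ?_
        rw [Real.norm_eq_abs, abs_mul]
        have : |Y n ω - X n ω| ≤ δ := not_lt.1 hω
        gcongr
    rw [dist_zero_right, hcf n _ (hY n), hcf n _ (hX n),
      ← integral_sub (hint n _ (hY n)) (hint n _ (hX n))]
    calc _ ≤ ∫ ω, (|t| * δ + B.indicator (fun _ => (2 : ℝ)) ω) ∂(P n) := by
          refine (norm_integral_le_integral_norm _).trans
            (integral_mono ((hint n _ (hY n)).sub (hint n _ (hX n))).norm ?_ hpt)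
          exact (integrable_const _).add ((integrable_const _).indicator₀ hBm)
      _ = |t| * δ + (P n).real B * 2 := by
          rw [integral_add (integrable_const _) ((integrable_const _).indicator₀ hBm),
            integral_indicator₀ hBm]
          simp
      _ < ε / 2 + ε / 4 * 2 := by
          refine add_lt_add_of_le_of_lt ?_ (by gcongr)
          rw [hδ]
          rw [mul_div_assoc', div_le_div_iff₀ (by positivity) (by positivity)]
          nlinarith [abs_nonneg t]
      _ = ε := by ring
  simpa using hdiff.add hlim

end CentralLimit

/-! ### Distribution functions, the uniform transform and absence of ties -/

namespace ZeroMedianDensity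

variable (f : ZeroMedianDensity)

theorem law_real_Iic (x : ℝ) : f.law.real (Iic x) = f.distFun x := by
  rw [measureReal_def, law, withDensity_apply _ measurableSet_Iic,
    ← ofReal_integral_eq_lintegral_ofReal f.integrable.integrableOn
      (ae_of_all _ fun x => (f.pos x).le)]
  exact ENNReal.toReal_ofReal (integral_nonneg fun x => (f.pos x).le)

theorem distFun_eq_cdf : f.distFun = cdf f.law := by
  ext x
  rw [cdf_eq_real, law_real_Iic]

theorem distFun_sub_distFun (x y : ℝ) : f.distFun y - f.distFun x = ∫ t in x..y, f.toFun t :=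
  intervalIntegral.integral_Iic_sub_Iic f.integrable.integrableOn f.integrable.integrableOn

theorem strictMono_distFun : StrictMono f.distFun := fun x y hxy => by
  rw [← sub_pos, distFun_sub_distFun]
  exact intervalIntegral.intervalIntegral_pos_of_pos f.integrable.intervalIntegrable f.pos hxy

theorem continuous_distFun : Continuous f.distFun := by
  have h : f.distFun = fun x => f.distFun 0 + ∫ t in (0 : ℝ)..x, f.toFun t := by
    ext x
    rw [← distFun_sub_distFun]
    ring
  rw [h]
  exact continuous_const.add
    (intervalIntegral.continuous_primitive (fun _ _ => f.integrable.intervalIntegrable) 0)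

theorem distFun_zero : f.distFun 0 = 1 / 2 := by
  rw [distFun, integral_Iic_eq_integral_Iio, f.integral_neg]

theorem distFun_mem_Ioo (x : ℝ) : f.distFun x ∈ Ioo (0 : ℝ) 1 := by
  have h0 : 0 ≤ f.distFun (x - 1) := by rw [distFun_eq_cdf]; exact cdf_nonneg _ _
  have h1 : f.distFun (x + 1) ≤ 1 := by rw [distFun_eq_cdf]; exact cdf_le_one _ _
  exact ⟨h0.trans_lt (f.strictMono_distFun (by linarith)),
    (f.strictMono_distFun (by linarith)).trans_le h1⟩

theorem exists_distFun_eq {u : ℝ} (hu : u ∈ Ioo (0 : ℝ) 1) : ∃ x, f.distFun x = u := by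
  have h0 : ∃ x, f.distFun x ≤ u := by
    rw [distFun_eq_cdf]
    exact ((tendsto_cdf_atBot f.law).eventually_le_const hu.1).exists
  have h1 : ∃ x, u ≤ f.distFun x := by
    rw [distFun_eq_cdf]
    exact ((tendsto_cdf_atTop f.law).eventually_const_le hu.2).exists
  exact mem_range_of_exists_le_of_exists_ge f.continuous_distFun h0 h1

/-- Probability integral transform. -/
theorem measurePreserving_distFun :
    MeasurePreserving f.distFun f.law (volume.restrict (Ioo (0 : ℝ) 1)) where
  measurable := f.continuous_distFun.measurable
  map_eq := by
    have := Measure.isProbabilityMeasure_map (μ := f.law)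
      f.continuous_distFun.measurable.aemeasurable
    refine Measure.ext_of_Iic _ _ fun u => ?_
    rw [Measure.map_apply f.continuous_distFun.measurable measurableSet_Iic,
      Measure.restrict_apply measurableSet_Iic]
    rcases le_or_gt u 0 with hu0 | hu0
    · have e1 : f.distFun ⁻¹' Iic u = ∅ := by
        ext x
        simpa using hu0.trans_lt (f.distFun_mem_Ioo x).1
      have e2 : Iic u ∩ Ioo (0 : ℝ) 1 = ∅ := by
        ext x
        simp only [mem_inter_iff, mem_Iic, mem_Ioo, mem_empty_iff_false, iff_false]
        intro h
        linarith [h.1, h.2.1]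
      rw [e1, e2, measure_empty, measure_empty]
    rcases le_or_gt 1 u with hu1 | hu1
    · have e1 : f.distFun ⁻¹' Iic u = univ := by
        ext x
        simpa using (f.distFun_mem_Ioo x).2.le.trans hu1
      have e2 : Iic u ∩ Ioo (0 : ℝ) 1 = Ioo 0 1 :=
        inter_eq_right.2 fun x hx => hx.2.le.trans hu1
      rw [e1, e2, measure_univ, Real.volume_Ioo]
      simp
    · obtain ⟨x, hx⟩ := f.exists_distFun_eq ⟨hu0, hu1⟩
      have e1 : f.distFun ⁻¹' Iic u = Iic x := by
        ext y
        rw [mem_preimage, mem_Iic, mem_Iic, ← hx, f.strictMono_distFun.le_iff_le]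
      have e2 : Iic u ∩ Ioo (0 : ℝ) 1 = Ioc 0 u := by
        ext y
        simp only [mem_inter_iff, mem_Iic, mem_Ioo, mem_Ioc]
        exact ⟨fun h => ⟨h.2.1, h.1⟩, fun h => ⟨h.2, h.1, h.2.trans_lt hu1⟩⟩
      rw [e1, e2, Real.volume_Ioc, sub_zero, ← hx, ← law_real_Iic, ofReal_measureReal]

theorem measurePreserving_distFun_pi (n : ℕ) :
    MeasurePreserving (fun (z : Fin n → ℝ) i => f.distFun (z i)) (f.whiteNoise n)
      (Measure.pi fun _ => volume.restrict (Ioo (0 : ℝ) 1)) :=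
  measurePreserving_pi _ _ fun _ => f.measurePreserving_distFun

/-- A white noise sample almost surely has no ties. -/
theorem ae_injective_whiteNoise (n : ℕ) : ∀ᵐ z ∂(f.whiteNoise n), Function.Injective z := by
  have : NullSingletonClass f.law := ⟨fun x =>
    withDensity_absolutelyContinuous volume _ (measure_singleton x)⟩
  have hne : ∀ i j : Fin n, i ≠ j → ∀ᵐ z ∂(f.whiteNoise n), z i ≠ z j := fun i j hij => by
    have hind : IndepFun (fun z : Fin n → ℝ => z i) (fun z => z j) (f.whiteNoise n) :=
      (iIndepFun_pi (μ := fun _ : Fin n => f.law) (X := fun _ x => x)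
        fun _ => aemeasurable_id).indepFun hij
    have hmap := (indepFun_iff_map_prod_eq_prod_map_map
      (measurable_pi_apply i).aemeasurable (measurable_pi_apply j).aemeasurable).1 hind
    have hev : ∀ k : Fin n, (f.whiteNoise n).map (fun z => z k) = f.law := fun k =>
      (measurePreserving_eval (fun _ : Fin n => f.law) k).map_eq
    rw [hev i, hev j] at hmap
    -- By Fubini: the sections of the diagonal are singletons, and the law has no atoms.
    have hdiag : (f.law.prod f.law) {p : ℝ × ℝ | p.1 = p.2} = 0 := by
      rw [Measure.measure_prod_null (measurableSet_eq_fun measurable_fst measurable_snd)]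
      refine ae_of_all _ fun x => ?_
      have : Prod.mk x ⁻¹' {p : ℝ × ℝ | p.1 = p.2} = {x} := by
        ext y
        simp [eq_comm]
      exact (congrArg f.law this).trans (measure_singleton x)
    rw [← hmap, Measure.map_apply (by fun_prop)
      (measurableSet_eq_fun measurable_fst measurable_snd)] at hdiag
    exact measure_eq_zero_iff_ae_notMem.1 hdiag
  have : ∀ᵐ z ∂(f.whiteNoise n), ∀ i j : Fin n, i ≠ j → z i ≠ z j := by
    simp only [ae_all_iff]
    exact hne
  filter_upwards [this] with z hz i j hij
  by_contra h
  exact hz i j h hij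

end ZeroMedianDensity

/-! ### Symmetry and distribution-freeness of signs and ranks -/

section Ranks

variable {n : ℕ}

theorem card_filter_comp_perm (σ : Equiv.Perm (Fin n)) (p : Fin n → Prop) [DecidablePred p] :
    (Finset.univ.filter fun i => p (σ i)).card = (Finset.univ.filter p).card := by
  simp only [Finset.card_filter]
  exact Equiv.sum_comp σ fun i => if p i then 1 else 0

theorem signCounts_comp_perm (σ : Equiv.Perm (Fin n)) (z : Fin n → ℝ) :
    signCounts (z ∘ σ) = signCounts z :=
  Prod.ext (card_filter_comp_perm σ fun i => z i < 0) (card_filter_comp_perm σ fun i => 0 < z i)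

theorem orderStat_comp_perm (σ : Equiv.Perm (Fin n)) (z : Fin n → ℝ) :
    orderStat (z ∘ σ) = orderStat z :=
  Tuple.comp_perm_comp_sort_eq_comp_sort

theorem rank_comp_perm (σ : Equiv.Perm (Fin n)) (z : Fin n → ℝ) (i : Fin n) :
    rank (z ∘ σ) i = rank z (σ i) :=
  card_filter_comp_perm σ fun j => z j ≤ z (σ i)

theorem equivariant_score (a : Scores) : Equivariant fun i (z : Fin n → ℝ) => score a i z :=
  fun σ i z => by
    have h := signCounts_comp_perm σ z
    simp only [signCounts, Prod.mk.injEq] at h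
    simp only [score, h.1, h.2, rank_comp_perm]

theorem equivariant_eval (ψ : ℝ → ℝ) : Equivariant fun i (z : Fin n → ℝ) => ψ (z i) :=
  fun _ _ _ => rfl

theorem measurable_score (a : Scores) (i : Fin n) : Measurable fun z => score a i z := by
  have hr : Measurable fun z : Fin n → ℝ => rank z i :=
    measurable_card_filter (fun (z : Fin n → ℝ) j => z j ≤ z i) fun j =>
      measurableSet_le (measurable_pi_apply j) (measurable_pi_apply i)
  exact (Measurable.of_discrete (f := fun p : (ℕ × ℕ) × ℕ => a n p.1.1 p.1.2 p.2)).comp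
    (measurable_signCounts.prodMk hr)

/-- For fixed `n` a score takes finitely many values, so arbitrary scores have all moments. -/
theorem memLp_score (a : Scores) (i : Fin n) (p : ℝ≥0∞) (P : Measure (Fin n → ℝ))
    [IsFiniteMeasure P] : MemLp (fun z => score a i z) p P := by
  have hcard : ∀ s : Finset (Fin n), s.card ∈ Finset.range (n + 1) := fun s =>
    Finset.mem_range_succ_iff.2 ((Finset.card_le_univ s).trans_eq (Fintype.card_fin n))
  refine MemLp.of_bound (measurable_score a i).aestronglyMeasurable
    (∑ x ∈ Finset.range (n + 1) ×ˢ Finset.range (n + 1) ×ˢ Finset.range (n + 1),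
      |a n x.1 x.2.1 x.2.2|) (ae_of_all _ fun z => ?_)
  exact Finset.single_le_sum (f := fun x : ℕ × ℕ × ℕ => |a n x.1 x.2.1 x.2.2|)
    (fun _ _ => abs_nonneg _) (a := (numNeg z, numPos z, rank z i))
    (Finset.mk_mem_product (hcard _) (Finset.mk_mem_product (hcard _) (hcard _)))

theorem rank_injective {z : Fin n → ℝ} (hz : Function.Injective z) :
    Function.Injective (rank z) := by
  have hlt : ∀ i j, z i < z j → rank z i < rank z j := fun i j hij => by
    refine Finset.card_lt_card ((Finset.ssubset_iff_of_subset fun k hk => ?_).2 ⟨j, ?_, ?_⟩)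
    · simp only [Finset.mem_filter, Finset.mem_univ, true_and] at hk ⊢
      exact hk.trans hij.le
    · simp
    · simpa using hij
  intro i j hij
  by_contra h
  rcases lt_or_gt_of_ne (hz.ne h) with h' | h'
  · exact (hlt _ _ h').ne hij
  · exact (hlt _ _ h').ne' hij

/-- In the absence of ties the ranks are a permutation of `1, …, n`. -/
theorem sum_rank_eq {z : Fin n → ℝ} (hz : Function.Injective z) (b : ℕ → ℝ) :
    ∑ i, b (rank z i) = ∑ k ∈ Finset.Icc 1 n, b k := by
  have himg : Finset.univ.image (rank z) = Finset.Icc 1 n := by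
    refine Finset.eq_of_subset_of_card_le (fun k hk => ?_) ?_
    · obtain ⟨i, -, rfl⟩ := Finset.mem_image.1 hk
      refine Finset.mem_Icc.2 ⟨Finset.card_pos.2 ⟨i, by simp⟩, ?_⟩
      exact (Finset.card_le_univ _).trans_eq (Fintype.card_fin n)
    · rw [Finset.card_image_of_injective _ (rank_injective hz)]
      simp
  rw [← himg, Finset.sum_image fun i _ j _ h => rank_injective hz h]

theorem preimage_perm_of_sigmaCounts (s : Set (Fin n → ℝ)) (hs : MeasurableSet[sigmaCounts n] s)
    (σ : Equiv.Perm (Fin n)) : (fun z => z ∘ σ) ⁻¹' s = s := by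
  obtain ⟨t, -, rfl⟩ := hs
  ext z
  simp only [mem_preimage, signCounts_comp_perm]

theorem preimage_perm_of_sigmaOrder (s : Set (Fin n → ℝ)) (hs : MeasurableSet[sigmaOrder n] s)
    (σ : Equiv.Perm (Fin n)) : (fun z => z ∘ σ) ⁻¹' s = s := by
  obtain ⟨t, -, rfl⟩ := hs
  ext z
  simp only [mem_preimage, orderStat_comp_perm]

/-- Symmetric measurable statistics are functions of the order statistics. -/
theorem measurable_sigmaOrder_of_symmetric {G : (Fin n → ℝ) → ℝ} (hG : Measurable G)
    (hsymm : ∀ (σ : Equiv.Perm (Fin n)) z, G (z ∘ σ) = G z) : Measurable[sigmaOrder n] G := by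
  -- Sorting is itself a permutation of the coordinates, depending on `z`.
  have h : G = G ∘ orderStat := by
    ext z
    exact (hsymm (Tuple.sort z) z).symm
  rw [h]
  exact hG.comp (comap_measurable orderStat)

/-- The score of a sample from the uniform distribution, with signs taken at the median `1 / 2`. -/
noncomputable def uniformScore (a : Scores) (i : Fin n) (u : Fin n → ℝ) : ℝ :=
  a n (Finset.univ.filter fun j => u j < 1 / 2).card
    (Finset.univ.filter fun j => 1 / 2 < u j).card (rank u i)

theorem measurable_uniformScore (a : Scores) (i : Fin n) : Measurable (uniformScore a i) := by
  have hr : Measurable fun z : Fin n → ℝ => rank z i :=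
    measurable_card_filter (fun (z : Fin n → ℝ) j => z j ≤ z i) fun j =>
      measurableSet_le (measurable_pi_apply j) (measurable_pi_apply i)
  have hm : Measurable fun z : Fin n → ℝ => (Finset.univ.filter fun j => z j < 1 / 2).card :=
    measurable_card_filter (fun (z : Fin n → ℝ) j => z j < 1 / 2) fun j =>
      measurableSet_lt (measurable_pi_apply j) measurable_const
  have hp : Measurable fun z : Fin n → ℝ => (Finset.univ.filter fun j => 1 / 2 < z j).card :=
    measurable_card_filter (fun (z : Fin n → ℝ) j => 1 / 2 < z j) fun j =>
      measurableSet_lt measurable_const (measurable_pi_apply j)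
  exact (Measurable.of_discrete (f := fun p : ℕ × ℕ × ℕ => a n p.1 p.2.1 p.2.2)).comp
    (hm.prodMk (hp.prodMk hr))

/-- `F` is strictly increasing with `F(0) = 1/2`, so it preserves ranks and carries signs to
positions relative to `1/2`. -/
theorem score_eq_uniformScore (f : ZeroMedianDensity) (a : Scores) (i : Fin n) (z : Fin n → ℝ) :
    score a i z = uniformScore a i fun j => f.distFun (z j) := by
  have hlt : ∀ j, f.distFun (z j) < 1 / 2 ↔ z j < 0 := fun j => by
    rw [← f.distFun_zero, f.strictMono_distFun.lt_iff_lt]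
  have hgt : ∀ j, 1 / 2 < f.distFun (z j) ↔ 0 < z j := fun j => by
    rw [← f.distFun_zero, f.strictMono_distFun.lt_iff_lt]
  simp only [score, uniformScore, numNeg, numPos, rank, hlt, hgt, f.strictMono_distFun.le_iff_le]

/-- Linear sign-and-rank statistics are distribution-free. -/
theorem map_sum_score_whiteNoise (f g : ZeroMedianDensity) (a : Scores) (w : Fin n → ℝ) :
    (f.whiteNoise n).map (fun z => ∑ i, w i * score a i z)
      = (g.whiteNoise n).map fun z => ∑ i, w i * score a i z := by
  have key : ∀ h : ZeroMedianDensity, (h.whiteNoise n).map (fun z => ∑ i, w i * score a i z)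
      = (Measure.pi fun _ => volume.restrict (Ioo (0 : ℝ) 1)).map
        fun u => ∑ i, w i * uniformScore a i u := fun h => by
    rw [← (h.measurePreserving_distFun_pi n).map_eq, Measure.map_map
      (Finset.measurable_sum _ fun i _ => (measurable_uniformScore a i).const_mul _)
      (h.measurePreserving_distFun_pi n).measurable]
    congr 1
    ext z
    simp only [score_eq_uniformScore h, Function.comp_apply]
  rw [key f, key g]

end Ranks

/-! ### Conditional centring and the score errors -/

section Projections

/-- Without ties the ranks exhaust `1, …, n`, so the sum depends on `N` alone. This is why
conditioning on `N`, rather than on the order statistics, suffices for the scores. -/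
theorem aestronglyMeasurable_sum_score (f : ZeroMedianDensity) (a : Scores) (n : ℕ) :
    AEStronglyMeasurable[sigmaCounts n] (fun z => ∑ i, score a i z) (f.whiteNoise n) := by
  refine ⟨fun z => ∑ k ∈ Finset.Icc 1 n, a n (numNeg z) (numPos z) k, ?_, ?_⟩
  · exact Measurable.stronglyMeasurable
      ((Measurable.of_discrete (f := fun p : ℕ × ℕ => ∑ k ∈ Finset.Icc 1 n, a n p.1 p.2 k)).comp
        (comap_measurable signCounts))
  · filter_upwards [f.ae_injective_whiteNoise n] with z hz
    exact sum_rank_eq hz fun k => a n (numNeg z) (numPos z) k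

/-- Symmetric sums of functions of the scores and of the observations are, up to null sets,
measurable with respect to the order statistics. -/
theorem aestronglyMeasurable_sigmaOrder_sum (f : ZeroMedianDensity) {n : ℕ}
    {Y : Fin n → (Fin n → ℝ) → ℝ} (hY : Equivariant Y) (hYm : ∀ i, Measurable (Y i))
    {ψ : ℝ → ℝ} (hψ : AEStronglyMeasurable ψ f.law) {H : ℝ → ℝ} (hH : Measurable H) :
    AEStronglyMeasurable[sigmaOrder n] (fun z => ∑ i, H (Y i z - ψ (z i))) (f.whiteNoise n) := by
  -- `ψ` is measurable only up to a null set; a measurable version makes the sum exactly a function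
  -- of the order statistics.
  have hm : Measurable (hψ.mk ψ) := hψ.stronglyMeasurable_mk.measurable
  refine ⟨fun z => ∑ i, H (Y i z - hψ.mk ψ (z i)), ?_, ?_⟩
  · refine Measurable.stronglyMeasurable (measurable_sigmaOrder_of_symmetric ?_ fun σ z => ?_)
    · exact Finset.measurable_sum _ fun i _ =>
        hH.comp ((hYm i).sub (hm.comp (measurable_pi_apply i)))
    · simp only [hY σ _ z]
      exact Equiv.sum_comp σ fun i => H (Y i z - hψ.mk ψ (z i))
  · have : ∀ᵐ z ∂(f.whiteNoise n), ∀ i : Fin n, ψ (z i) = hψ.mk ψ (z i) := by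
      rw [ae_all_iff]
      exact fun i => (measurePreserving_eval (fun _ : Fin n => f.law) i).quasiMeasurePreserving.ae
        hψ.ae_eq_mk
    filter_upwards [this] with z hz
    simp only [hz]

/-- Subtracting a conditional expectation given symmetric events centres the regression
constants. -/
theorem sub_condExp_ae_eq (f : ZeroMedianDensity) {n : ℕ}
    {m : MeasurableSpace (Fin n → ℝ)} (hm : m ≤ MeasurableSpace.pi)
    (hsymm : ∀ s, MeasurableSet[m] s → ∀ σ : Equiv.Perm (Fin n), (fun z => z ∘ σ) ⁻¹' s = s)
    {X : Fin n → (Fin n → ℝ) → ℝ} (hX : Equivariant X)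
    (hint : ∀ i, Integrable (X i) (f.whiteNoise n))
    (hmeas : AEStronglyMeasurable[m] (fun z => ∑ i, X i z) (f.whiteNoise n))
    (c : RegConstants) :
    (fun z => (1 / n) * ∑ i, c n i * X i z -
        ((f.whiteNoise n)[fun z => (1 / n) * ∑ i, c n i * X i z | m]) z) =ᵐ[f.whiteNoise n]
      fun z => (1 / n) * ∑ i, (c n i - cBar c n) * X i z := by
  have e : (fun z => (1 / (n : ℝ)) * ∑ i, c n i * X i z)
      = fun z => ∑ i, (1 / n * c n i) * X i z := by
    ext z
    rw [Finset.mul_sum]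
    exact Finset.sum_congr rfl fun i _ => (mul_assoc _ _ _).symm
  have h := condExp_sum_mul_ae_eq f.law hm hsymm hX hint hmeas fun i => 1 / n * c n i
  rw [e]
  filter_upwards [h] with z hz
  rw [show ((f.whiteNoise n)[fun z => ∑ i, (1 / n * c n i) * X i z | m]) z = _ from hz,
    ← Finset.mul_sum]
  simp only [sub_mul, Finset.sum_sub_distrib, ← Finset.mul_sum, cBar]
  ring

theorem signRankStat_sub_condExp_ae_eq (f : ZeroMedianDensity) (c : RegConstants) (a : Scores)
    (n : ℕ) :
    (fun z => signRankStat c a n z - ((f.whiteNoise n)[signRankStat c a n | sigmaCounts n]) z)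
      =ᵐ[f.whiteNoise n] fun z => (1 / n) * ∑ i, (c n i - cBar c n) * score a i z :=
  sub_condExp_ae_eq f (sigmaCounts_le n) preimage_perm_of_sigmaCounts (equivariant_score a)
    (fun i => (memLp_score a i 1 _).integrable le_rfl) (aestronglyMeasurable_sum_score f a n) c

theorem memLp_comp_eval (f : ZeroMedianDensity) {ψ : ℝ → ℝ} (hψ : MemLp ψ 2 f.law) {n : ℕ}
    (i : Fin n) : MemLp (fun z => ψ (z i)) 2 (f.whiteNoise n) :=
  hψ.comp_measurePreserving (measurePreserving_eval (fun _ : Fin n => f.law) i)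

theorem memLp_comp_distFun (f : ZeroMedianDensity) {φ : ℝ → ℝ}
    (hφ : MemLp φ 2 (volume.restrict (Ioo (0 : ℝ) 1))) :
    MemLp (fun x => φ (f.distFun x)) 2 f.law :=
  hφ.comp_measurePreserving f.measurePreserving_distFun

theorem paramStat_sub_condExp_ae_eq (f : ZeroMedianDensity) (c : RegConstants) {φ : ℝ → ℝ}
    (hφ : MemLp φ 2 (volume.restrict (Ioo (0 : ℝ) 1))) (n : ℕ) :
    (fun z => paramStat c φ f n z - ((f.whiteNoise n)[paramStat c φ f n | sigmaOrder n]) z)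
      =ᵐ[f.whiteNoise n] fun z => (1 / n) * ∑ i, (c n i - cBar c n) * φ (f.distFun (z i)) := by
  refine sub_condExp_ae_eq f (sigmaOrder_le n) preimage_perm_of_sigmaOrder
    (equivariant_eval fun x => φ (f.distFun x))
    (fun i => (memLp_comp_eval f (memLp_comp_distFun f hφ) i).integrable one_le_two) ?_ c
  -- With `Y = 0`, the negation `H` undoes the sign in `Y - ψ`.
  have h := aestronglyMeasurable_sigmaOrder_sum f (n := n) (Y := fun _ _ => 0)
    (fun _ _ _ => rfl) (fun _ => measurable_const) (memLp_comp_distFun f hφ).aestronglyMeasurable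
    (H := fun x => -x) measurable_neg
  simpa only [zero_sub, neg_neg] using h

/-- The discrepancies between exact and approximate scores. -/
noncomputable def scoreError (f : ZeroMedianDensity) (φ : ℝ → ℝ) (a : Scores) (n : ℕ) (i : Fin n)
    (z : Fin n → ℝ) : ℝ :=
  score a i z - φ (f.distFun (z i))

theorem equivariant_scoreError (f : ZeroMedianDensity) (φ : ℝ → ℝ) (a : Scores) (n : ℕ) :
    Equivariant (scoreError f φ a n) :=
  (equivariant_score a).sub (equivariant_eval fun x => φ (f.distFun x))

theorem memLp_scoreError (f : ZeroMedianDensity) {φ : ℝ → ℝ} (a : Scores)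
    (hφ : MemLp φ 2 (volume.restrict (Ioo (0 : ℝ) 1))) (n : ℕ) (i : Fin n) :
    MemLp (scoreError f φ a n i) 2 (f.whiteNoise n) :=
  (memLp_score a i 2 _).sub (memLp_comp_eval f (memLp_comp_distFun f hφ) i)

/-- Given the order statistics, the expected squared error of the first score is the average of all
squared errors. -/
theorem isLittleOInProb_mean_sq_scoreError (f : ZeroMedianDensity) {φ : ℝ → ℝ} {a : Scores}
    (hφ : MemLp φ 2 (volume.restrict (Ioo (0 : ℝ) 1))) (hgen : IsScoreGenerating f φ a) :
    IsLittleOInProb (fun n => f.whiteNoise n)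
      (fun n z => 1 / n * ∑ i, scoreError f φ a n i z ^ 2) fun _ => 1 := by
  intro ε hε
  rw [← tendsto_add_atTop_iff_nat 1]
  refine (hgen ε hε).congr fun n => measure_congr ?_
  have h := condExp_sum_mul_ae_eq f.law (sigmaOrder_le (n + 1)) preimage_perm_of_sigmaOrder
    (equivariant_scoreError f φ a (n + 1)).sq
    (fun i => (memLp_scoreError f a hφ (n + 1) i).integrable_sq)
    (aestronglyMeasurable_sigmaOrder_sum f (equivariant_score a) (measurable_score a)
      (memLp_comp_distFun f hφ).aestronglyMeasurable (H := fun x => x ^ 2) (by fun_prop))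
    -- Weights selecting the first coordinate; their sum is 1.
    (Pi.single 0 1)
  simp only [Pi.single_apply, ite_mul, one_mul, zero_mul, Finset.sum_ite_eq', Finset.mem_univ,
    if_true] at h
  filter_upwards [h] with z hz
  have hz' : ((f.whiteNoise (n + 1))[fun z => (score a 0 z - φ (f.distFun (z 0))) ^ 2 |
    sigmaOrder (n + 1)]) z = 1 / (n + 1 : ℕ) * ∑ i, scoreError f φ a (n + 1) i z ^ 2 := hz
  exact congrArg (fun x => ε * 1 < |x|) hz'

end Projections

/-! ### Normalized regression constants -/

section RegressionConstants

theorem sum_sub_cBar (c : RegConstants) (n : ℕ) : ∑ i, (c n i - cBar c n) = 0 := by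
  rcases Nat.eq_zero_or_pos n with rfl | hn
  · simp
  · have : (n : ℝ) ≠ 0 := by positivity
    simp only [Finset.sum_sub_distrib, Finset.sum_const, Finset.card_univ, Fintype.card_fin,
      nsmul_eq_mul, cBar]
    field_simp
    ring

theorem sumSq_nonneg (c : RegConstants) (n : ℕ) : 0 ≤ sumSq c n :=
  Finset.sum_nonneg fun _ _ => sq_nonneg _

theorem NoetherCondition.sumSq_pos {c : RegConstants} (hc : NoetherCondition c) :
    ∀ᶠ n in atTop, 0 < sumSq c n := by
  filter_upwards [hc.not_all_equal] with n ⟨i, j, hij⟩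
  refine (sumSq_nonneg c n).lt_of_ne fun h => hij ?_
  have h0 := (Finset.sum_eq_zero_iff_of_nonneg fun k _ => sq_nonneg (c n k - cBar c n)).1 h.symm
  have hi := pow_eq_zero_iff (two_ne_zero) |>.1 (h0 i (Finset.mem_univ _))
  have hj := pow_eq_zero_iff (two_ne_zero) |>.1 (h0 j (Finset.mem_univ _))
  linarith

/-- Centred and normalized regression constants. -/
noncomputable def normalizedWeight (c : RegConstants) (n : ℕ) (i : Fin n) : ℝ :=
  (c n i - cBar c n) / √(sumSq c n)

theorem sum_normalizedWeight (c : RegConstants) (n : ℕ) : ∑ i, normalizedWeight c n i = 0 := by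
  simp only [normalizedWeight, ← Finset.sum_div, sum_sub_cBar, zero_div]

theorem NoetherCondition.sum_sq_normalizedWeight {c : RegConstants} (hc : NoetherCondition c) :
    ∀ᶠ n in atTop, ∑ i, normalizedWeight c n i ^ 2 = 1 := by
  filter_upwards [hc.sumSq_pos] with n hn
  simp only [normalizedWeight, div_pow, Real.sq_sqrt hn.le, ← Finset.sum_div]
  exact div_self hn.ne'

theorem NoetherCondition.abs_normalizedWeight_lt {c : RegConstants} (hc : NoetherCondition c)
    (ε : ℝ) (hε : 0 < ε) : ∀ᶠ n in atTop, ∀ i, |normalizedWeight c n i| < ε := by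
  filter_upwards [hc.tendsto_zero.eventually_lt_const (show (0 : ℝ) < ε ^ 2 by positivity),
    hc.sumSq_pos] with n hn hpos i
  refine abs_lt_of_sq_lt_sq ?_ hε.le
  rw [normalizedWeight, div_pow, Real.sq_sqrt hpos.le]
  refine lt_of_le_of_lt ?_ hn
  gcongr
  exact le_ciSup (f := fun i : Fin n => (c n i - cBar c n) ^ 2) (Set.finite_range _).bddAbove i

end RegressionConstants

/-! ### The limiting variance -/

section ScoreVariance

theorem scoreVariance_eq_variance {φ : ℝ → ℝ}
    (hφ : MemLp φ 2 (volume.restrict (Ioo (0 : ℝ) 1))) (f : ZeroMedianDensity) :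
    variance (fun x => φ (f.distFun x)) f.law = scoreVariance φ := by
  have hF := f.measurePreserving_distFun
  have h1 : ∫ x, φ (f.distFun x) ∂f.law = ∫ u in Ioo (0 : ℝ) 1, φ u := by
    rw [← hF.map_eq, integral_map hF.measurable.aemeasurable]
    rw [hF.map_eq]
    exact hφ.aestronglyMeasurable
  have h2 : ∫ x, φ (f.distFun x) ^ 2 ∂f.law = ∫ u in Ioo (0 : ℝ) 1, φ u ^ 2 := by
    rw [← hF.map_eq, integral_map hF.measurable.aemeasurable (f := fun u => φ u ^ 2)]
    rw [hF.map_eq]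
    exact hφ.aestronglyMeasurable.pow 2
  rw [variance_eq_sub (memLp_comp_distFun f hφ), scoreVariance, h1, ← h2]
  rfl

/-- Zero variance would force `φ` to equal its mean almost everywhere. -/
theorem scoreVariance_pos {φ : ℝ → ℝ}
    (hφ : MemLp φ 2 (volume.restrict (Ioo (0 : ℝ) 1)))
    (hconst : ∀ k : ℝ, ¬ (φ =ᵐ[volume.restrict (Ioo (0 : ℝ) 1)] fun _ => k)) :
    0 < scoreVariance φ := by
  have : IsProbabilityMeasure (volume.restrict (Ioo (0 : ℝ) 1)) := ⟨by simp⟩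
  have he : scoreVariance φ = variance φ (volume.restrict (Ioo (0 : ℝ) 1)) := by
    rw [variance_eq_sub hφ]
    rfl
  rw [he]
  refine (variance_nonneg _ _).lt_of_ne fun h => ?_
  exact hconst _ (ae_eq_integral_of_variance_eq_zero hφ h.symm)

end ScoreVariance

/-! ### Asymptotic representation and normality -/

/-- Convergence in law of the normalized statistic, in terms of characteristic functions. -/
theorem tendsto_charFun_sum_score (f : ZeroMedianDensity) {φ : ℝ → ℝ} {a : Scores}
    {c : RegConstants} (hφ : MemLp φ 2 (volume.restrict (Ioo (0 : ℝ) 1)))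
    (hconst : ∀ k : ℝ, ¬ (φ =ᵐ[volume.restrict (Ioo (0 : ℝ) 1)] fun _ => k))
    (hgen : IsScoreGenerating f φ a) (hc : NoetherCondition c) (t : ℝ) :
    Tendsto (fun n => charFun ((f.whiteNoise n).map
      fun z => ∑ i, normalizedWeight c n i * score a i z) t) atTop
      (𝓝 (charFun (gaussianReal 0 (scoreVariance φ).toNNReal) t)) := by
  have hψ := memLp_comp_distFun f hφ
  have hpos := scoreVariance_pos hφ hconst
  have hclt := tendsto_charFun_weighted_sum f.law hψ
    (by rwa [scoreVariance_eq_variance hφ]) (Eventually.of_forall (sum_normalizedWeight c))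
    hc.sum_sq_normalizedWeight hc.abs_normalizedWeight_lt t
  -- Replacing scores by `φ(F(Zᵢ))` costs only a negligible error, so the scores inherit the limit
  -- in `hclt`.
  have hneg := isLittleOInProb_sum_mul f.law (equivariant_scoreError f φ a)
    (memLp_scoreError f a hφ) (isLittleOInProb_mean_sq_scoreError f hφ hgen)
    (Eventually.of_forall (sum_normalizedWeight c))
    (hc.sum_sq_normalizedWeight.mono fun n hn => hn.le)
  have hlim : Complex.exp (-(variance (fun x => φ (f.distFun x)) f.law * t ^ 2 / 2 : ℝ))
      = charFun (gaussianReal 0 (scoreVariance φ).toNNReal) t := by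
    rw [charFun_gaussianReal, scoreVariance_eq_variance hφ, Real.coe_toNNReal _ hpos.le]
    push_cast
    ring_nf
  rw [← hlim]
  refine tendsto_charFun_of_isLittleOInProb_sub (fun n => f.whiteNoise n)
    (fun n => ?_) (fun n => ?_) ?_ hclt
  · exact Finset.aemeasurable_fun_sum _ fun i _ =>
      ((memLp_comp_eval f hψ i).aestronglyMeasurable.aemeasurable).const_mul _
  · exact Finset.aemeasurable_fun_sum _ fun i _ => (measurable_score a i).aemeasurable.const_mul _
  · simp only [← Finset.sum_sub_distrib, ← mul_sub]
    exact hneg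

/-- The powers of `n` cancel; at `n = 0` the left side is 0 by the conventions for division. -/
theorem sqrt_mul_div_sqrt_eq (n : ℕ) {s : ℝ} (x : ℝ) :
    √(n : ℝ) * (1 / n * x) / √(1 / (n : ℝ) * s) = if n = 0 then 0 else x / √s := by
  split_ifs with hn
  · simp [hn]
  · have hn' : (0 : ℝ) < n := by exact_mod_cast Nat.pos_of_ne_zero hn
    have h : 0 < √(n : ℝ) := Real.sqrt_pos.2 hn'
    have hinv : 1 / (n : ℝ) = 1 / (√(n : ℝ) * √(n : ℝ)) := by rw [Real.mul_self_sqrt hn'.le]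
    rw [Real.sqrt_mul (by positivity), Real.sqrt_div zero_le_one, Real.sqrt_one,
      ← mul_div_mul_left (x) (√s) (show 1 / √(n : ℝ) ≠ 0 by positivity)]
    congr 1
    rw [hinv]
    field_simp

/-- After multiplication by `√n` the difference is a combination of score errors with weights `(cᵢ -
c̄)/√n`, whose squares have bounded sum by the `O(n)` condition. -/
theorem asymptotic_representation (f : ZeroMedianDensity) {φ : ℝ → ℝ} {a : Scores}
    {c : RegConstants} (hφ : MemLp φ 2 (volume.restrict (Ioo (0 : ℝ) 1)))
    (hgen : IsScoreGenerating f φ a)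
    (hc : (fun n => sumSq c n) =O[atTop] (fun n : ℕ => (n : ℝ))) :
    IsLittleOInProb (fun n => f.whiteNoise n)
      (fun n z =>
        (signRankStat c a n z - ((f.whiteNoise n)[signRankStat c a n | sigmaCounts n]) z) -
        (paramStat c φ f n z - ((f.whiteNoise n)[paramStat c φ f n | sigmaOrder n]) z))
      (fun n => 1 / √(n : ℝ)) := by
  obtain ⟨C, hC⟩ := hc.bound
  have hneg := isLittleOInProb_sum_mul f.law (equivariant_scoreError f φ a)
    (memLp_scoreError f a hφ) (isLittleOInProb_mean_sq_scoreError f hφ hgen)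
    (w := fun n i => (c n i - cBar c n) / √(n : ℝ)) (C := C)
    (Eventually.of_forall fun n => by rw [← Finset.sum_div, sum_sub_cBar, zero_div])
    (by
      filter_upwards [hC, eventually_gt_atTop 0] with n hn hn0
      have hn' : (0 : ℝ) < n := by exact_mod_cast hn0
      simp only [div_pow, Real.sq_sqrt hn'.le, ← Finset.sum_div]
      rw [div_le_iff₀ hn']
      rw [Real.norm_of_nonneg (sumSq_nonneg c n), Real.norm_of_nonneg hn'.le] at hn
      exact hn)
  intro ε hε
  refine (hneg ε hε).congr' ?_
  filter_upwards [eventually_gt_atTop 0] with n hn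
  refine measure_congr ?_
  filter_upwards [signRankStat_sub_condExp_ae_eq f c a n, paramStat_sub_condExp_ae_eq f c hφ n]
    with z hS hT
  have hn' : (0 : ℝ) < n := by exact_mod_cast hn
  have h : 0 < √(n : ℝ) := Real.sqrt_pos.2 hn'
  have hinv : 1 / (n : ℝ) = 1 / (√(n : ℝ) * √(n : ℝ)) := by rw [Real.mul_self_sqrt hn'.le]
  have hsum : ∑ i, (c n i - cBar c n) / √(n : ℝ) * scoreError f φ a n i z
      = √(n : ℝ) * (1 / n * ∑ i, (c n i - cBar c n) * score a i z -
        1 / n * ∑ i, (c n i - cBar c n) * φ (f.distFun (z i))) := by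
    rw [← mul_sub, ← Finset.sum_sub_distrib, Finset.mul_sum, Finset.mul_sum]
    refine Finset.sum_congr rfl fun i _ => ?_
    rw [scoreError, hinv]
    field_simp
  refine propext ?_
  change ε * 1 < |∑ i, (c n i - cBar c n) / √(n : ℝ) * scoreError f φ a n i z| ↔
    ε * (1 / √(n : ℝ)) < |_ - _|
  rw [hS, hT, hsum, abs_mul, abs_of_pos h, mul_one, mul_one_div, div_lt_iff₀' h]

theorem asymptotic_normality (f : ZeroMedianDensity) {φ : ℝ → ℝ} {a : Scores}
    {c : RegConstants} (hφ : MemLp φ 2 (volume.restrict (Ioo (0 : ℝ) 1)))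
    (hconst : ∀ k : ℝ, ¬ (φ =ᵐ[volume.restrict (Ioo (0 : ℝ) 1)] fun _ => k))
    (hgen : IsScoreGenerating f φ a) (hc : NoetherCondition c) (g : ZeroMedianDensity) :
    TendstoInDistribution
      (fun (n : ℕ) z =>
        √(n : ℝ) *
          (signRankStat c a n z - ((g.whiteNoise n)[signRankStat c a n | sigmaCounts n]) z) /
          √((1 / (n : ℝ)) * sumSq c n))
      atTop (id : ℝ → ℝ) (fun n => g.whiteNoise n)
      (gaussianReal 0 (scoreVariance φ).toNNReal) := by
  have hmeas : ∀ n, AEMeasurable (fun z : Fin n → ℝ => ∑ i, normalizedWeight c n i * score a i z)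
      (g.whiteNoise n) := fun n => Finset.aemeasurable_fun_sum _ fun i _ =>
    (measurable_score a i).aemeasurable.const_mul _
  have hae : ∀ n, (fun z : Fin n → ℝ => ∑ i, normalizedWeight c n i * score a i z)
      =ᵐ[g.whiteNoise n] fun z => √(n : ℝ) *
        (signRankStat c a n z - ((g.whiteNoise n)[signRankStat c a n | sigmaCounts n]) z) /
        √((1 / (n : ℝ)) * sumSq c n) := fun n => by
    filter_upwards [signRankStat_sub_condExp_ae_eq g c a n] with z hz
    rw [hz, sqrt_mul_div_sqrt_eq]
    split_ifs with hn
    · subst hn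
      simp
    · rw [Finset.sum_div]
      exact Finset.sum_congr rfl fun i _ => by rw [normalizedWeight]; ring
  refine TendstoInDistribution.congr hae (ae_eq_refl _) ⟨hmeas, aemeasurable_id, ?_⟩
  refine ProbabilityMeasure.tendsto_iff_tendsto_charFun.2 fun t => ?_
  have h := tendsto_charFun_sum_score f hφ hconst hgen hc t
  -- The limit was obtained under `f`, where the scores are approximated; equality of laws carries
  -- it to `g`.
  simp only [map_sum_score_whiteNoise f g] at h
  simpa using h

end SignRank

theorem lemma3p1
    (f : ZeroMedianDensity) (φ : ℝ → ℝ) (a : Scores) (c : RegConstants)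
    (hφ_sq : MemLp φ 2 (volume.restrict (Ioo (0 : ℝ) 1)))
    (hφ_nonconst : ∀ k : ℝ, ¬ (φ =ᵐ[volume.restrict (Ioo (0 : ℝ) 1)] fun _ => k))
    (hφ_gen : IsScoreGenerating f φ a)
    (hc_noether : NoetherCondition c)
    (hc_bound : (fun n => sumSq c n) =O[atTop] (fun n : ℕ => (n : ℝ))) :
    -- (i) asymptotic representation, under white noise with density `f`
    IsLittleOInProb (fun n => f.whiteNoise n)
      (fun n z =>
        (signRankStat c a n z - ((f.whiteNoise n)[signRankStat c a n | sigmaCounts n]) z) -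
        (paramStat c φ f n z - ((f.whiteNoise n)[paramStat c φ f n | sigmaOrder n]) z))
      (fun n => 1 / √(n : ℝ)) ∧
    -- (ii) asymptotic normality, under white noise with any zero-median density `g`
    (IntegrableOn (fun u => φ u ^ 2) (Ioo (0 : ℝ) 1) ∧ IntegrableOn φ (Ioo (0 : ℝ) 1) ∧
      0 < scoreVariance φ) ∧
    ∀ g : ZeroMedianDensity,
      TendstoInDistribution
        (fun (n : ℕ) z =>
          √(n : ℝ) *
            (signRankStat c a n z - ((g.whiteNoise n)[signRankStat c a n | sigmaCounts n]) z) /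
            √((1 / (n : ℝ)) * sumSq c n))
        atTop (id : ℝ → ℝ) (fun n => g.whiteNoise n)
        (gaussianReal 0 (scoreVariance φ).toNNReal) :=
  ⟨asymptotic_representation f hφ_sq hφ_gen hc_bound,
    ⟨hφ_sq.integrable_sq, hφ_sq.integrable one_le_two, scoreVariance_pos hφ_sq hφ_nonconst⟩,
    asymptotic_normality f hφ_sq hφ_nonconst hφ_gen hc_noether⟩
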